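/- Let $(a_k)_{k\in\mathbb Z}$ be a sequence of complex numbers with $a_{-k}=\overline{a_k}$ for all $k$, and suppose that it decays exponentially: there are constants $C$ and $\gamma>0$ with $|a_k|\le C e^{-\gamma|k|}$ for all $k\in\mathbb Z$. For $n\ge 1$ let $A_n=(a_{k-l})_{k,l=0}^{n-1}$ be the $n\times n$ hermitian Toeplitz matrix generated by this sequence. Let $B_n$ be the $n\times n$ Toeplitz matrix that occurs in the embedding of $A_n$ into the $2n\times 2n$ matrix $$C_{2n}=\begin{bmatrix}A_n & B_n^*\\ B_n & A_n\end{bmatrix}$$ with circulant structure, that is, $(B_n)_{kl}=a_{n-(l-k)}$ for $k<l$, $(B_n)_{kl}=a_{k-l-n}=\overline{a_{n-(k-l)}}$ for $k>l$, and $(B_n)_{kk}=b_0^{(n)}$, where for each $n$ either $b_0^{(n)}=a_n$ or $b_0^{(n)}=0$. Whenever $A_n$ is invertible (for instance, when it is positive definite), set $$S_n=A_n-B_nA_n^{-1}B_n^*.$$ Then for every $\varepsilon>0$ there exist $N$ and $M$ such that, for all $n>N$ for which $A_n$ is invertible, at most $M$ eigenvalues of $A_n-S_n$, counted with multiplicity,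 have absolute value exceeding $\varepsilon$. -/

import Mathlib

/-- The `n × n` Toeplitz matrix `A_n = (a_{k-l})`, `0 ≤ k, l < n`, i.e. the `n`-th finite section
of the biinfinite Toeplitz matrix generated by the sequence `a`. -/
def toeplitzSection (a : ℤ → ℂ) (n : ℕ) : Matrix (Fin n) (Fin n) ℂ :=
  fun k l => a ((k : ℤ) - (l : ℤ))

/-- The `n × n` Toeplitz matrix `B_n` for which `[[A_n, B_nᴴ], [B_n, A_n]]` is the circulant
embedding of `A_n`. Its first row is `(b₀, a_{n-1}, a_{n-2}, …, a_1)`, and below the diagonal the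
circulant structure (index `n + (k - l)` modulo `2n`) forces the entries `a_{k-l-n}`. -/
def embeddingBlock (a : ℤ → ℂ) (b₀ : ℂ) (n : ℕ) : Matrix (Fin n) (Fin n) ℂ :=
  fun k l =>
    if k < l then a ((n : ℤ) - ((l : ℤ) - (k : ℤ)))
    else if k = l then b₀
    else a ((k : ℤ) - (l : ℤ) - (n : ℤ))

/-- `S_n = A_n - B_n A_n⁻¹ B_nᴴ`, the Schur complement (meaningful when `A_n` is invertible). -/
noncomputable def embeddingSchur (a : ℤ → ℂ) (b₀ : ℂ) (n : ℕ) : Matrix (Fin n) (Fin n) ℂ :=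
  toeplitzSection a n -
    embeddingBlock a b₀ n * (toeplitzSection a n)⁻¹ * (embeddingBlock a b₀ n).conjTranspose

open Classical in
/-- The number of eigenvalues of a complex matrix, counted with (algebraic) multiplicity, whose
absolute value exceeds `ε`. -/
noncomputable def numEigenvaluesAbove {n : ℕ} (X : Matrix (Fin n) (Fin n) ℂ) (ε : ℝ) : ℕ :=
  X.charpoly.roots.countP (fun z => ε < ‖z‖)

/-! Here `A - S = B A⁻¹ Bᴴ` is hermitian, so it suffices to bound it by `ε` on a subspace whose
codimension is independent of `n`. With `y = A⁻¹ Bᴴ x` this means `‖B y‖ ≤ δ ‖A y‖`, because `A y =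
Bᴴ x` and `Bᴴ` is uniformly bounded. Let `F` be the symbol, `X` the polynomial with coefficients
`y`, and `U = F X`. The frequencies of `U` in `[0, n)` give `A y`; those outside give `B y` up to
exponentially small entries (`norm_embeddingBlock_mulVec_le`). Exponential decay makes `F` analytic
near the circle, so `F q = P` with `P` a polynomial having all its roots on the circle and `q`
zero-free. Approximating a multiple of `q` by a trigonometric polynomial `h` makes `h F` close to a
multiple of `P`, relative to `|F|`. If `U` has no frequencies near `0` and `n`, boundedly many
linear conditions, its part outside `[0, n)` is then small (`sqNorm_sub_lowPart_le`). The zeros of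
`F` may make `A` ill-conditioned, but dividing by `P` costs only a power of `n`
(`norm_coeff_le_of_mul_rootProd`), which the exponentially small entries absorb. -/

open MeasureTheory AddCircle Metric Filter Topology

/-! ### Zeros on the unit circle -/

/-- A function analytic near the unit circle and not identically zero on it is a product of
finitely many linear factors vanishing on the circle and a zero-free continuous function. -/
theorem AnalyticOnNhd.exists_factorization_sphere {f : ℂ → ℂ}
    (hf : AnalyticOnNhd ℂ f (sphere 0 1)) (hne : ∃ z ∈ sphere (0 : ℂ) 1, f z ≠ 0) :
    ∃ (s : Multiset ℂ) (g : ℂ → ℂ), (∀ ζ ∈ s, ‖ζ‖ = 1) ∧ ContinuousOn g (sphere 0 1) ∧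
      (∀ z ∈ sphere (0 : ℂ) 1, g z ≠ 0) ∧
      ∀ z ∈ sphere (0 : ℂ) 1, f z = (s.map fun ζ => z - ζ).prod * g z := by
  classical
  have hpre : IsPreconnected (sphere (0 : ℂ) 1) :=
    isPreconnected_sphere (by rw [Complex.rank_real_complex]; norm_num) _ _
  have horder : ∀ u : sphere (0 : ℂ) 1, meromorphicOrderAt f u ≠ ⊤ := by
    intro u hu
    rw [(hf u u.2).meromorphicOrderAt_eq] at hu
    have hu' : analyticOrderAt f u = ⊤ := by simpa using hu
    rw [analyticOrderAt_eq_top] at hu'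
    obtain ⟨z, hz, hfz⟩ := hne
    exact hfz (hf.eqOn_zero_of_preconnected_of_eventuallyEq_zero hpre u.2 hu' hz)
  have hfin : (MeromorphicOn.divisor f (sphere (0 : ℂ) 1)).support.Finite :=
    divisor_sphere_support_finite
  obtain ⟨g, hg, hg0, hfg⟩ := hf.meromorphicOn.extract_zeros_poles horder hfin
  have hD0 : ∀ u, 0 ≤ MeromorphicOn.divisor f (sphere (0 : ℂ) 1) u :=
    fun u => MeromorphicOn.AnalyticOnNhd.divisor_nonneg hf u
  set D := MeromorphicOn.divisor f (sphere (0 : ℂ) 1) with hD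
  refine ⟨∑ u ∈ hfin.toFinset, Multiset.replicate (D u).toNat u, g, ?_, hg.continuousOn,
    fun z hz => hg0 ⟨z, hz⟩, ?_⟩
  · intro ζ hζ
    rw [Multiset.mem_sum] at hζ
    obtain ⟨u, hu, huζ⟩ := hζ
    rw [Multiset.eq_of_mem_replicate huζ]
    have : u ∈ sphere (0 : ℂ) 1 := D.supportWithinDomain (by simpa using hu)
    simpa using this
  · intro z hz
    have hprod : ((∑ u ∈ hfin.toFinset, Multiset.replicate (D u).toNat u).map
        fun ζ => z - ζ).prod = (∏ᶠ u, (· - u) ^ D u : ℂ → ℂ) z := by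
      rw [finprod_eq_prod_of_mulSupport_subset (s := hfin.toFinset)
        _ (by simp [Function.FactorizedRational.mulSupport]), Finset.prod_apply,
        ← Multiset.coe_mapAddMonoidHom, map_sum, Multiset.prod_sum]
      refine Finset.prod_congr rfl fun u _ => ?_
      simp only [Multiset.coe_mapAddMonoidHom, Multiset.map_replicate, Multiset.prod_replicate,
        Pi.pow_apply]
      rw [← zpow_natCast, Int.toNat_of_nonneg (hD0 u)]
    rw [hprod]
    -- The factorization is known only off a discrete set; both sides are analytic (the divisor is
    -- nonnegative), so continuity extends it to every point of the circle.
    have hacc : AccPt z (𝓟 (sphere (0 : ℂ) 1)) :=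
      hpre.preperfect_of_nontrivial ⟨1, by simp, -1, by simp, by norm_num⟩ z hz
    have hP : AnalyticAt ℂ (∏ᶠ u, (· - u) ^ D u : ℂ → ℂ) z :=
      Function.FactorizedRational.analyticAt (hD0 z)
    have hPg := hP.smul (hg z hz)
    have := (hf z hz).meromorphicAt.eventuallyEq_nhdsNE_of_eventuallyEq_codiscreteWithin
      hPg.meromorphicAt hz hacc hfg
    rw [ContinuousAt.eventuallyEq_nhds_iff_eventuallyEq_nhdsNE (hf z hz).continuousAt
      hPg.continuousAt] at this
    exact this.self_of_nhds

/-! ### Fourier coefficients, Parseval and bandwidth -/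

namespace CircleFourier

/-- The `k`-th Fourier coefficient as a continuous linear functional. -/
noncomputable def coeff (k : ℤ) : C(UnitAddCircle, ℂ) →L[ℂ] ℂ :=
  LinearMap.mkContinuous
    { toFun := fun G => fourierCoeff G k
      map_add' := fun G H => by
        rw [ContinuousMap.coe_add, fourierCoeff.add]
        · rfl
        · exact G.continuous.integrable_of_hasCompactSupport (HasCompactSupport.of_compactSpace _)
        · exact H.continuous.integrable_of_hasCompactSupport (HasCompactSupport.of_compactSpace _)
      map_smul' := fun c G => by
        rw [ContinuousMap.coe_smul, fourierCoeff.const_smul]; rfl } 1 fun G => by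
    have := norm_integral_le_of_norm_le_const (μ := (haarAddCircle : Measure UnitAddCircle))
      (f := fun t => fourier (-k) t • G t) (C := ‖G‖) (ae_of_all _ fun t => by
        rw [norm_smul, fourier_apply, Circle.norm_coe, one_mul]; exact G.norm_coe_le_norm t)
    simpa [fourierCoeff] using this

theorem coeff_apply (k : ℤ) (G : C(UnitAddCircle, ℂ)) : coeff k G = fourierCoeff G k := rfl

theorem coeff_fourier_mul (j k : ℤ) (G : C(UnitAddCircle, ℂ)) :
    coeff k (fourier j * G) = coeff (k - j) G := by
  simp only [coeff_apply, fourierCoeff]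
  refine integral_congr_ae (ae_of_all _ fun t => ?_)
  simp only [ContinuousMap.mul_apply, smul_eq_mul]
  rw [← mul_assoc, ← fourier_add, neg_sub, sub_eq_add_neg, add_comm]

theorem coeff_fourier (j k : ℤ) : coeff k (fourier j) = if k = j then 1 else 0 := by
  rw [coeff_apply, ← fourierCoeff_congr_ae (coeFn_fourierLp 2 j), ← fourierBasis_repr,
    ← coe_fourierBasis, HilbertBasis.repr_self, lp.single_apply]
  simp [Pi.single_apply]

/-- The square of the `L²` norm of a continuous function on the circle. -/
noncomputable def sqNorm (G : C(UnitAddCircle, ℂ)) : ℝ := ∫ t, ‖G t‖ ^ 2 ∂haarAddCircle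

theorem hasSum_sq_coeff (G : C(UnitAddCircle, ℂ)) :
    HasSum (fun k => ‖coeff k G‖ ^ 2) (sqNorm G) := by
  have h := hasSum_sq_fourierCoeff (ContinuousMap.toLp 2 haarAddCircle ℂ G)
  have e := ContinuousMap.coeFn_toLp (p := 2) (𝕜 := ℂ) haarAddCircle G
  rw [fourierCoeff_congr_ae e, integral_congr_ae (g := fun t => ‖G t‖ ^ 2)
    (by filter_upwards [e] with t ht; rw [ht])] at h
  exact h

theorem sqNorm_nonneg (G : C(UnitAddCircle, ℂ)) : 0 ≤ sqNorm G :=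
  integral_nonneg fun _ => by positivity

theorem sqNorm_le {G H : C(UnitAddCircle, ℂ)} {c : ℝ} (h : ∀ t, ‖G t‖ ≤ c * ‖H t‖) :
    sqNorm G ≤ c ^ 2 * sqNorm H := by
  rw [sqNorm, sqNorm, ← integral_const_mul]
  have hi : ∀ G : C(UnitAddCircle, ℂ),
      Integrable (fun t => ‖G t‖ ^ 2) (haarAddCircle : Measure UnitAddCircle) := fun G =>
    (by fun_prop : Continuous fun t => ‖G t‖ ^ 2).integrable_of_hasCompactSupport
      (HasCompactSupport.of_compactSpace _)
  refine integral_mono (hi G) ((hi H).const_mul _) fun t => ?_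
  simp only
  rw [← mul_pow]
  exact pow_le_pow_left₀ (norm_nonneg _) (h t) 2

theorem sum_sq_coeff_le {ι : Type*} [Fintype ι] (G : C(UnitAddCircle, ℂ)) {e : ι → ℤ}
    (he : Function.Injective e) : ∑ i, ‖coeff (e i) G‖ ^ 2 ≤ sqNorm G := by
  have := sum_le_hasSum (Finset.univ.map ⟨e, he⟩) (fun _ _ => by positivity) (hasSum_sq_coeff G)
  simpa using this

theorem norm_coeff_le (G : C(UnitAddCircle, ℂ)) (k : ℤ) : ‖coeff k G‖ ≤ √(sqNorm G) :=
  Real.le_sqrt_of_sq_le (le_hasSum (hasSum_sq_coeff G) k fun _ _ => by positivity)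

/-- Multiplication by `h` shifts Fourier coefficients by at most `m`. -/
def HasBandwidth (h : C(UnitAddCircle, ℂ)) (m : ℕ) : Prop :=
  ∀ (G : C(UnitAddCircle, ℂ)) (k : ℤ), (∀ j, |j - k| ≤ m → coeff j G = 0) → coeff k (h * G) = 0

theorem HasBandwidth.mono {h : C(UnitAddCircle, ℂ)} {m m' : ℕ} (hh : HasBandwidth h m)
    (hm : m ≤ m') : HasBandwidth h m' := fun G k hG =>
  hh G k fun j hj => hG j (hj.trans (by exact_mod_cast hm))

theorem HasBandwidth.mul {h₁ h₂ : C(UnitAddCircle, ℂ)} {m₁ m₂ : ℕ} (hh₁ : HasBandwidth h₁ m₁)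
    (hh₂ : HasBandwidth h₂ m₂) : HasBandwidth (h₁ * h₂) (m₁ + m₂) := by
  intro G k hG
  rw [mul_assoc]
  refine hh₁ _ _ fun j hj => hh₂ _ _ fun i hi => hG i ?_
  have := abs_add_le (i - j) (j - k)
  rw [sub_add_sub_cancel] at this
  push_cast
  linarith

theorem hasBandwidth_fourier (j : ℤ) : HasBandwidth (fourier j) j.natAbs := by
  intro G k hG
  rw [coeff_fourier_mul]
  exact hG _ (by simp)

theorem HasBandwidth.add {h₁ h₂ : C(UnitAddCircle, ℂ)} {m₁ m₂ : ℕ} (hh₁ : HasBandwidth h₁ m₁)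
    (hh₂ : HasBandwidth h₂ m₂) : HasBandwidth (h₁ + h₂) (m₁ + m₂) := by
  intro G k hG
  rw [add_mul, map_add, hh₁.mono (Nat.le_add_right _ _) G k hG,
    hh₂.mono (Nat.le_add_left _ _) G k hG, add_zero]

theorem HasBandwidth.smul {h : C(UnitAddCircle, ℂ)} {m : ℕ} (hh : HasBandwidth h m) (c : ℂ) :
    HasBandwidth (c • h) m := by
  intro G k hG
  rw [smul_mul_assoc, map_smul, hh G k hG, smul_zero]

theorem exists_hasBandwidth_of_mem_span {h : C(UnitAddCircle, ℂ)}
    (hh : h ∈ Submodule.span ℂ (Set.range (@fourier (1 : ℝ)))) : ∃ m, HasBandwidth h m := by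
  induction hh using Submodule.span_induction with
  | mem x hx => obtain ⟨j, rfl⟩ := hx; exact ⟨_, hasBandwidth_fourier j⟩
  | zero => exact ⟨0, fun G k _ => by simp⟩
  | add x y _ _ hx hy =>
    obtain ⟨m₁, h₁⟩ := hx
    obtain ⟨m₂, h₂⟩ := hy
    exact ⟨_, h₁.add h₂⟩
  | smul c x _ hx => obtain ⟨m, h⟩ := hx; exact ⟨m, h.smul c⟩

/-- Continuous functions on the circle are uniform limits of functions of finite bandwidth. -/
theorem exists_hasBandwidth_approx (G : C(UnitAddCircle, ℂ)) {η : ℝ} (hη : 0 < η) :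
    ∃ h m, HasBandwidth h m ∧ ∀ t, ‖h t - G t‖ ≤ η := by
  have hG : G ∈ (Submodule.span ℂ (Set.range (@fourier (1 : ℝ)))).topologicalClosure := by
    rw [span_fourier_closure_eq_top]; trivial
  obtain ⟨h, hh, hd⟩ := Metric.mem_closure_iff.1 hG η hη
  obtain ⟨m, hm⟩ := exists_hasBandwidth_of_mem_span hh
  refine ⟨h, m, hm, fun t => ?_⟩
  rw [← dist_eq_norm, dist_comm]
  exact (ContinuousMap.dist_apply_le_dist t).trans hd.le

/-! ### Trigonometric polynomials and truncation of frequencies -/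

/-- The trigonometric polynomial with coefficients `c 0, …, c (n - 1)`. -/
noncomputable def trigPoly {n : ℕ} (c : Fin n → ℂ) : C(UnitAddCircle, ℂ) :=
  ∑ l, c l • fourier (l : ℤ)

theorem coeff_mul_trigPoly {n : ℕ} (c : Fin n → ℂ) (F : C(UnitAddCircle, ℂ)) (k : ℤ) :
    coeff k (F * trigPoly c) = ∑ l : Fin n, coeff (k - (l : ℤ)) F * c l := by
  rw [trigPoly, Finset.mul_sum, map_sum]
  refine Finset.sum_congr rfl fun l _ => ?_
  rw [mul_smul_comm, map_smul, mul_comm F, coeff_fourier_mul, smul_eq_mul, mul_comm]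

theorem coeff_trigPoly_apply {n : ℕ} (c : Fin n → ℂ) (l : Fin n) :
    coeff (l : ℤ) (trigPoly c) = c l := by
  simp only [trigPoly, map_sum, map_smul, coeff_fourier, smul_eq_mul]
  rw [Finset.sum_eq_single l]
  · simp
  · intro b _ hb
    rw [if_neg (fun h => hb (Fin.ext (by exact_mod_cast h.symm))), mul_zero]
  · simp

theorem coeff_trigPoly_eq_zero {n : ℕ} (c : Fin n → ℂ) {k : ℤ} (hk : k < 0 ∨ n ≤ k) :
    coeff k (trigPoly c) = 0 := by
  simp only [trigPoly, map_sum, map_smul, coeff_fourier, smul_eq_mul]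
  refine Finset.sum_eq_zero fun l _ => ?_
  rw [if_neg (by have := l.2; omega), mul_zero]

theorem sqNorm_trigPoly {n : ℕ} (c : Fin n → ℂ) : sqNorm (trigPoly c) = ∑ l, ‖c l‖ ^ 2 := by
  refine (hasSum_sq_coeff _).unique ?_
  have he : Function.Injective (fun l : Fin n => (l : ℤ)) :=
    fun a b h => Fin.ext (by simpa using h)
  rw [Finset.sum_congr rfl fun l _ => by rw [← coeff_trigPoly_apply c l],
    show ∑ l : Fin n, ‖coeff (l : ℤ) (trigPoly c)‖ ^ 2 =
      ∑ k ∈ Finset.univ.map ⟨_, he⟩, ‖coeff k (trigPoly c)‖ ^ 2 by simp]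
  refine hasSum_sum_of_ne_finset_zero fun k hk => ?_
  rw [coeff_trigPoly_eq_zero, norm_zero, zero_pow two_ne_zero]
  by_contra! h
  refine hk (Finset.mem_map.2 ⟨⟨k.toNat, by omega⟩, Finset.mem_univ _, ?_⟩)
  simp; omega

/-- The part of the Fourier series of `U` with frequencies in `[0, n)`. -/
noncomputable def lowPart (n : ℕ) (U : C(UnitAddCircle, ℂ)) : C(UnitAddCircle, ℂ) :=
  trigPoly fun l : Fin n => coeff (l : ℤ) U

theorem coeff_lowPart (n : ℕ) (U : C(UnitAddCircle, ℂ)) (k : ℤ) :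
    coeff k (lowPart n U) = if 0 ≤ k ∧ k < n then coeff k U else 0 := by
  split_ifs with h
  · have := coeff_trigPoly_apply (fun l : Fin n => coeff (l : ℤ) U) ⟨k.toNat, by omega⟩
    simpa [lowPart, h.1] using this
  · exact coeff_trigPoly_eq_zero _ (by omega)

theorem sqNorm_eq_lowPart_add (n : ℕ) (U : C(UnitAddCircle, ℂ)) :
    sqNorm U = sqNorm (lowPart n U) + sqNorm (U - lowPart n U) := by
  refine (hasSum_sq_coeff U).unique ?_
  convert (hasSum_sq_coeff (lowPart n U)).add (hasSum_sq_coeff (U - lowPart n U)) using 2 with k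
  rw [map_sub, coeff_lowPart]
  split_ifs <;> simp

/-- If `h F` is relatively close to a function `P`, both `h` and `P` having bandwidth `m`, then,
for `X` with frequencies in `[0, n)` and `U = F X` without frequencies near the end points of
`[0, n)`, the part of `U` outside `[0, n)` is relatively small. -/
theorem sqNorm_sub_lowPart_le {F h P X : C(UnitAddCircle, ℂ)} {m n : ℕ} {η : ℝ}
    (hh : HasBandwidth h m) (hP : HasBandwidth P m) (h1 : ∀ t, 1 ≤ ‖h t‖)
    (h2 : ∀ t, ‖h t * F t - P t‖ ≤ η * ‖F t‖)
    (hX : ∀ k : ℤ, k < 0 ∨ n ≤ k → coeff k X = 0)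
    (hU : ∀ k : ℤ, (-(2 * m) ≤ k ∧ k < m) ∨ (n - m ≤ k ∧ k < n + 2 * m) → coeff k (F * X) = 0) :
    sqNorm (F * X - lowPart n (F * X)) ≤ η ^ 2 * sqNorm (F * X) := by
  set U := F * X with hUdef
  set Y := lowPart n U with hY
  have hr : sqNorm (h * U - P * X) ≤ η ^ 2 * sqNorm U := by
    refine sqNorm_le fun t => ?_
    have : (h * U - P * X) t = (h t * F t - P t) * X t := by
      simp [hUdef]; ring
    rw [this, norm_mul, hUdef, ContinuousMap.mul_apply, norm_mul, ← mul_assoc]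
    exact mul_le_mul_of_nonneg_right (h2 t) (norm_nonneg _)
  have hT : sqNorm (U - Y) ≤ sqNorm (h * (U - Y)) := by
    have := sqNorm_le (G := U - Y) (H := h * (U - Y)) (c := 1) fun t => by
      rw [ContinuousMap.mul_apply, norm_mul, one_mul]
      exact le_mul_of_one_le_left (norm_nonneg _) (h1 t)
    simpa using this
  refine hT.trans (le_trans ?_ hr)
  refine hasSum_le (fun k => ?_) (hasSum_sq_coeff _) (hasSum_sq_coeff _)
  -- For `k` in this window, multiplication by `h` reaches at most `2 * m` beyond `[0, n)`, where
  -- `U` vanishes by `hU`. For other `k`, neither `P * X` nor `h * Y` has a frequency there, so the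
  -- two sides agree.
  by_cases hk : -m ≤ k ∧ k < n + m
  · rw [hh (U - Y) k, norm_zero, zero_pow two_ne_zero]
    · positivity
    · intro j hj
      rw [abs_le] at hj
      rw [map_sub, hY, coeff_lowPart]
      split_ifs with hjn
      · rw [sub_self]
      · rw [hU j (by omega), sub_zero]
  · have e1 : coeff k (P * X) = 0 := hP _ _ fun j hj => hX j (by rw [abs_le] at hj; omega)
    have e2 : coeff k (h * Y) = 0 := hh _ _ fun j hj => by
      rw [abs_le] at hj
      rw [hY, coeff_lowPart]
      split_ifs with hjn
      · exact hU j (by omega)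
      · rfl
    rw [mul_sub, map_sub, map_sub, e1, e2]

/-! ### Division by linear factors with roots on the circle -/

/-- The trigonometric polynomial `∏ (z - ζ)`. -/
noncomputable def rootProd (s : Multiset ℂ) : C(UnitAddCircle, ℂ) :=
  (s.map fun ζ => fourier 1 - algebraMap ℂ C(UnitAddCircle, ℂ) ζ).prod

theorem rootProd_apply (s : Multiset ℂ) (t : UnitAddCircle) :
    rootProd s t = (s.map fun ζ => (toCircle t : ℂ) - ζ).prod := by
  induction s using Multiset.induction_on with
  | empty => simp [rootProd]
  | cons ζ s ih =>
    rw [rootProd, Multiset.map_cons, Multiset.prod_cons, ContinuousMap.mul_apply, ← rootProd, ih]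
    simp

theorem hasBandwidth_rootProd (s : Multiset ℂ) : HasBandwidth (rootProd s) s.card := by
  induction s using Multiset.induction_on with
  | empty => intro G k hG; simpa [rootProd] using hG k (by simp)
  | cons ζ s ih =>
    rw [rootProd, Multiset.map_cons, Multiset.prod_cons, ← rootProd, Multiset.card_cons, add_comm]
    refine HasBandwidth.mul (m₁ := 1) (fun G k hG => ?_) ih
    rw [sub_mul, map_sub, coeff_fourier_mul, ← Algebra.smul_def, map_smul, hG k (by simp),
      hG (k - 1) (by simp)]
    simp

/-- Division by `z - ζ` with `|ζ| = 1` increases the coefficients of a polynomial by at most a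
factor comparable to the degree. -/
theorem norm_coeff_le_of_mul_linear {n : ℕ} {ζ : ℂ} (hζ : ‖ζ‖ = 1) {G : C(UnitAddCircle, ℂ)}
    (hG : ∀ k : ℤ, k < 0 ∨ n ≤ k → coeff k G = 0) {D : ℝ}
    (hD : ∀ k, ‖coeff k ((fourier 1 - algebraMap ℂ C(UnitAddCircle, ℂ) ζ) * G)‖ ≤ D) (k : ℤ) :
    ‖coeff k G‖ ≤ n * D := by
  have hD0 : 0 ≤ D := (norm_nonneg _).trans (hD 0)
  -- Comparing coefficients gives a recursion with multiplier of modulus one, so errors add up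
  -- instead of growing geometrically.
  have hstep : ∀ j : ℤ, ‖coeff j G‖ ≤ ‖coeff (j - 1) G‖ + D := by
    intro j
    have e : ζ * coeff j G = coeff (j - 1) G -
        coeff j ((fourier 1 - algebraMap ℂ C(UnitAddCircle, ℂ) ζ) * G) := by
      rw [sub_mul, map_sub, coeff_fourier_mul, ← Algebra.smul_def, map_smul, smul_eq_mul]
      ring
    calc ‖coeff j G‖ = ‖ζ * coeff j G‖ := by rw [norm_mul, hζ, one_mul]
      _ ≤ _ := by rw [e]; exact (norm_sub_le _ _).trans (add_le_add_right (hD j) _)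
  have hind : ∀ i : ℕ, ‖coeff ((i : ℤ) - 1) G‖ ≤ i * D := by
    intro i
    induction i with
    | zero => simp [hG (-1) (by simp)]
    | succ i ih =>
      have := hstep i
      push_cast
      rw [add_sub_cancel_right]
      linarith
  by_cases hk : k < 0 ∨ n ≤ k
  · rw [hG k hk, norm_zero]; positivity
  · have h1 := hind (k.toNat + 1)
    have e : (((k.toNat + 1 : ℕ) : ℤ) - 1) = k := by omega
    rw [e] at h1
    refine h1.trans (mul_le_mul_of_nonneg_right ?_ hD0)
    exact_mod_cast (by omega : k.toNat + 1 ≤ n)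

/-- Remove the factors one at a time. Each costs at most the current length, which never exceeds `n
+ s.card`. -/
theorem norm_coeff_le_of_mul_rootProd (s : Multiset ℂ) (hs : ∀ ζ ∈ s, ‖ζ‖ = 1) :
    ∀ {n : ℕ} {G : C(UnitAddCircle, ℂ)}, (∀ k : ℤ, k < 0 ∨ n ≤ k → coeff k G = 0) →
      ∀ {D : ℝ}, (∀ k, ‖coeff k (rootProd s * G)‖ ≤ D) →
        ∀ k : ℤ, ‖coeff k G‖ ≤ (n + s.card) ^ s.card * D := by
  induction s using Multiset.induction_on with
  | empty => intro n G _ D hD k; simpa [rootProd] using hD k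
  | cons ζ s ih =>
    intro n G hG D hD k
    have hD0 : 0 ≤ D := (norm_nonneg _).trans (hD 0)
    set W := (fourier 1 - algebraMap ℂ C(UnitAddCircle, ℂ) ζ) * G with hW
    have hWs : ∀ k : ℤ, k < 0 ∨ (n + 1 : ℕ) ≤ k → coeff k W = 0 := by
      intro k hk
      push_cast at hk
      rw [hW, sub_mul, map_sub, coeff_fourier_mul, ← Algebra.smul_def, map_smul,
        hG k (by omega), hG (k - 1) (by omega)]
      simp
    have hWD : ∀ k, ‖coeff k (rootProd s * W)‖ ≤ D := by
      intro k
      have := hD k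
      rwa [rootProd, Multiset.map_cons, Multiset.prod_cons, ← rootProd, mul_comm _ (rootProd s),
        mul_assoc] at this
    have h1 := ih (fun ζ h => hs ζ (Multiset.mem_cons_of_mem h)) hWs hWD
    refine (norm_coeff_le_of_mul_linear (hs ζ (Multiset.mem_cons_self _ _)) hG h1 k).trans ?_
    rw [← mul_assoc, Multiset.card_cons, pow_succ']
    refine mul_le_mul_of_nonneg_right ?_ hD0
    push_cast
    have : ((n : ℝ) + 1 + s.card) = n + (s.card + 1) := by ring
    rw [this]
    exact mul_le_mul_of_nonneg_right (by linarith [(s.card.cast_nonneg : (0:ℝ) ≤ _)])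
      (by positivity)

end CircleFourier

/-! ### The symbol of an exponentially decaying sequence -/

namespace CircleFourier

theorem summable_exp_neg_mul_abs_int {c : ℝ} (hc : 0 < c) :
    Summable fun k : ℤ => Real.exp (-c * |(k : ℝ)|) := by
  have h : Summable fun n : ℕ => Real.exp (-c * n) := by
    have := summable_geometric_of_lt_one (Real.exp_pos (-c)).le
      (Real.exp_lt_one_iff.2 (by linarith : -c < 0))
    refine this.congr fun n => ?_
    rw [← Real.exp_nat_mul, mul_comm]
  refine Summable.of_nat_of_neg ?_ ?_ <;> simpa using h

/-- The continuous function on the circle with absolutely convergent Fourier series `a`. -/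
noncomputable def symbol (a : ℤ → ℂ) : C(UnitAddCircle, ℂ) := ∑' k, a k • fourier k

theorem hasSum_symbol {a : ℤ → ℂ} (ha : Summable fun k => ‖a k‖) :
    HasSum (fun k => a k • fourier k) (symbol a) := by
  refine (Summable.of_norm ?_).hasSum
  simpa [norm_smul, fourier_norm] using ha

theorem coeff_symbol {a : ℤ → ℂ} (ha : Summable fun k => ‖a k‖) (k : ℤ) :
    coeff k (symbol a) = a k := by
  refine ((coeff k).hasSum (hasSum_symbol ha)).unique ?_
  have : a k = (coeff k) (a k • fourier k) := by simp [coeff_fourier]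
  rw [this]
  refine hasSum_single k fun j hj => ?_
  simp [coeff_fourier, hj.symm]

theorem symbol_apply {a : ℤ → ℂ} (ha : Summable fun k => ‖a k‖) (t : UnitAddCircle) :
    symbol a t = ∑' k, a k * (toCircle t : ℂ) ^ k := by
  have := (ContinuousMap.evalCLM ℂ t).hasSum (hasSum_symbol ha)
  refine (this.tsum_eq.symm.trans ?_)
  refine tsum_congr fun k => ?_
  simp [toCircle_zsmul]

theorem analyticOnNhd_laurent {a : ℤ → ℂ} {C γ : ℝ} (hγ : 0 < γ)
    (ha : ∀ k : ℤ, ‖a k‖ ≤ C * Real.exp (-γ * |(k : ℝ)|)) :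
    AnalyticOnNhd ℂ (fun z : ℂ => ∑' k, a k * z ^ k) (sphere 0 1) := by
  have hC : 0 ≤ C := by simpa using (norm_nonneg _).trans (ha 0)
  -- Half the decay rate is given up to the growth of `z ^ k`; the other half keeps the series
  -- uniformly summable.
  set U : Set ℂ := {z | Real.exp (-(γ / 2)) < ‖z‖ ∧ ‖z‖ < Real.exp (γ / 2)} with hU
  have hUo : IsOpen U :=
    (isOpen_lt continuous_const continuous_norm).inter (isOpen_lt continuous_norm continuous_const)
  have hU0 : ∀ z ∈ U, z ≠ 0 := by
    rintro z ⟨hz, -⟩ rfl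
    rw [norm_zero] at hz
    exact absurd hz (Real.exp_pos _).le.not_gt
  have hd : DifferentiableOn ℂ (fun z : ℂ => ∑' k, a k * z ^ k) U := by
    refine Complex.differentiableOn_tsum_of_summable_norm
      ((summable_exp_neg_mul_abs_int (half_pos hγ)).mul_left C) (fun k => ?_) hUo ?_
    · intro z hz
      exact ((differentiableAt_zpow.2 (Or.inl (hU0 z hz))).const_mul _).differentiableWithinAt
    · intro k z hz
      have hz0 : 0 < ‖z‖ := norm_pos_iff.2 (hU0 z hz)
      have hlog : |Real.log ‖z‖| ≤ γ / 2 := by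
        rw [abs_le]
        exact ⟨((Real.lt_log_iff_exp_lt hz0).2 hz.1).le, ((Real.log_lt_iff_lt_exp hz0).2 hz.2).le⟩
      have hzk : ‖z ^ k‖ ≤ Real.exp (γ / 2 * |(k : ℝ)|) := by
        rw [norm_zpow, ← Real.rpow_intCast, Real.rpow_def_of_pos hz0, Real.exp_le_exp]
        refine (le_abs_self _).trans ?_
        rw [abs_mul]
        exact mul_le_mul_of_nonneg_right hlog (abs_nonneg _)
      rw [norm_mul]
      refine (mul_le_mul (ha k) hzk (norm_nonneg _) (by positivity)).trans ?_
      rw [mul_assoc, ← Real.exp_add]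
      exact le_of_eq (by ring_nf)
  intro z hz
  refine hd.analyticAt (hUo.mem_nhds ?_)
  rw [mem_sphere_zero_iff_norm] at hz
  rw [hU, Set.mem_ofPred_eq, hz]
  exact ⟨Real.exp_lt_one_iff.2 (by linarith), Real.one_lt_exp_iff.2 (by linarith)⟩

/-- A nonzero symbol with exponentially decaying coefficients is, up to a nonvanishing factor, a
product of linear factors with roots on the unit circle. -/
theorem exists_rootProd_eq_symbol_mul {a : ℤ → ℂ} {C γ : ℝ} (hγ : 0 < γ)
    (ha : ∀ k : ℤ, ‖a k‖ ≤ C * Real.exp (-γ * |(k : ℝ)|)) (hne : ∃ k, a k ≠ 0) :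
    ∃ (s : Multiset ℂ) (q : C(UnitAddCircle, ℂ)), (∀ ζ ∈ s, ‖ζ‖ = 1) ∧ (∀ t, q t ≠ 0) ∧
      rootProd s = symbol a * q := by
  have hs : Summable fun k => ‖a k‖ := Summable.of_nonneg_of_le (fun _ => norm_nonneg _) ha
    ((summable_exp_neg_mul_abs_int hγ).mul_left C)
  have hmem : ∀ t : UnitAddCircle, (toCircle t : ℂ) ∈ sphere (0 : ℂ) 1 := fun t => by
    rw [mem_sphere_zero_iff_norm, Circle.norm_coe]
  have hne' : ∃ z ∈ sphere (0 : ℂ) 1, ∑' k, a k * z ^ k ≠ 0 := by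
    by_contra! h
    obtain ⟨k, hk⟩ := hne
    apply hk
    have h0 : symbol a = 0 := by
      ext t
      rw [symbol_apply hs, h _ (hmem t)]
      rfl
    rw [← coeff_symbol hs, h0, map_zero]
  obtain ⟨s, g, hs1, hg, hg0, hfg⟩ :=
    (analyticOnNhd_laurent hγ ha).exists_factorization_sphere hne'
  have hgc : Continuous fun t : UnitAddCircle => g (toCircle t) :=
    hg.comp_continuous (by fun_prop) hmem
  refine ⟨s, ⟨fun t => (g (toCircle t))⁻¹, hgc.inv₀ fun t => hg0 _ (hmem t)⟩, hs1,
    fun t => inv_ne_zero (hg0 _ (hmem t)), ?_⟩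
  ext t
  rw [ContinuousMap.mul_apply, symbol_apply hs, rootProd_apply, ContinuousMap.coe_mk,
    hfg _ (hmem t), mul_assoc, mul_inv_cancel₀ (hg0 _ (hmem t)), mul_one]

/-- For `P = F q` with `q` nonvanishing, a multiple of `P` is relatively close to a multiple of `F`
by a function of finite bandwidth bounded below by `1`. -/
theorem exists_hasBandwidth_mul_approx {F P q : C(UnitAddCircle, ℂ)} (hq : ∀ t, q t ≠ 0)
    (hP : P = F * q) {η : ℝ} (hη : 0 < η) :
    ∃ (c : ℂ) (h : C(UnitAddCircle, ℂ)) (m : ℕ), HasBandwidth h m ∧ (∀ t, 1 ≤ ‖h t‖) ∧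
      ∀ t, ‖h t * F t - (c • P) t‖ ≤ η * ‖F t‖ := by
  let qi : C(UnitAddCircle, ℂ) := ⟨fun t => (q t)⁻¹, q.continuous.inv₀ hq⟩
  -- This scaling gives `|c q| ≥ 2`, so an approximation within `1` still satisfies `|h| ≥ 1`.
  set c : ℝ := 2 * ‖qi‖ with hc
  have hlow : ∀ t, 2 ≤ ‖((c : ℂ) • q) t‖ := by
    intro t
    have h1 : ‖(q t)⁻¹‖ ≤ ‖qi‖ := qi.norm_coe_le_norm t
    have h2 : 0 < ‖q t‖ := norm_pos_iff.2 (hq t)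
    rw [norm_inv, inv_le_iff_one_le_mul₀ h2] at h1
    rw [ContinuousMap.smul_apply, norm_smul, Complex.norm_real, Real.norm_of_nonneg (by positivity)]
    linarith
  obtain ⟨h, m, hm, happ⟩ := exists_hasBandwidth_approx ((c : ℂ) • q) (lt_min hη one_pos)
  refine ⟨c, h, m, hm, fun t => ?_, fun t => ?_⟩
  · have h1 := (happ t).trans (min_le_right _ _)
    have h2 := norm_sub_norm_le (((c : ℂ) • q) t) (h t)
    rw [norm_sub_rev] at h2
    linarith [hlow t]
  · have : h t * F t - ((c : ℂ) • P) t = (h t - ((c : ℂ) • q) t) * F t := by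
      simp [hP]; ring
    rw [this, norm_mul]
    exact mul_le_mul_of_nonneg_right ((happ t).trans (min_le_left _ _)) (norm_nonneg _)

end CircleFourier

/-! ### Toeplitz matrices as truncated multiplication operators -/

open CircleFourier

theorem toeplitzSection_mulVec {a : ℤ → ℂ} (ha : Summable fun k => ‖a k‖) {n : ℕ} (x : Fin n → ℂ)
    (k : Fin n) : (toeplitzSection a n).mulVec x k = coeff (k : ℤ) (symbol a * trigPoly x) := by
  simp only [coeff_mul_trigPoly, coeff_symbol ha]
  rfl

theorem sqNorm_lowPart_symbol_mul {a : ℤ → ℂ} (ha : Summable fun k => ‖a k‖) {n : ℕ}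
    (x : Fin n → ℂ) : sqNorm (lowPart n (symbol a * trigPoly x)) =
      ‖WithLp.toLp 2 ((toeplitzSection a n).mulVec x)‖ ^ 2 := by
  rw [EuclideanSpace.norm_sq_eq, lowPart, sqNorm_trigPoly]
  simp [toeplitzSection_mulVec ha]

/-- Up to small entries, `B_n x` collects the entries of the biinfinite convolution `a * x` at the
positions within distance `n` of `[0, n)`. -/
theorem norm_embeddingBlock_mulVec_le {a : ℤ → ℂ} (ha : Summable fun k => ‖a k‖) {n : ℕ} {κ : ℝ}
    (hκ : ∀ k : ℤ, n ≤ |k| → ‖a k‖ ≤ κ) {b : ℂ} (hb : ‖b‖ ≤ κ) (x : Fin n → ℂ) {D : ℝ}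
    (hD : ∀ l, ‖x l‖ ≤ D) :
    ‖WithLp.toLp 2 ((embeddingBlock a b n).mulVec x)‖ ≤
      2 * √(sqNorm (symbol a * trigPoly x - lowPart n (symbol a * trigPoly x))) +
        3 * n ^ 2 * κ * D := by
  have hκ0 : 0 ≤ κ := (norm_nonneg _).trans hb
  set U := symbol a * trigPoly x with hU
  set T := U - lowPart n U with hT
  -- The convolution at positions `n + k` and `k - n` contributes both subtracted terms. Off the
  -- diagonal one of them is the entry of `B_n` and the other has index at least `n` in modulus; on
  -- the diagonal three small terms remain, hence `3 * κ`.
  let E : Matrix (Fin n) (Fin n) ℂ := fun k l =>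
    embeddingBlock a b n k l - a (n + k - l) - a (k - n - l)
  have hE : ∀ k l, ‖E k l‖ ≤ 3 * κ := by
    intro k l
    simp only [E, embeddingBlock]
    have hk := k.2
    have hl := l.2
    split_ifs with h1 h2
    · rw [Fin.lt_def] at h1
      have e : (n : ℤ) - ((l : ℤ) - (k : ℤ)) = n + k - l := by ring
      rw [e, sub_self, zero_sub, norm_neg]
      linarith [hκ ((k : ℤ) - n - l) (by rw [abs_of_nonpos (by omega)]; omega)]
    · subst h2
      refine (norm_sub_le _ _).trans ?_
      have h3 := norm_sub_le b (a (n + k - k))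
      have h4 := hκ (n + k - k) (by rw [abs_of_nonneg (by omega)]; omega)
      have h5 := hκ ((k : ℤ) - n - k) (by rw [abs_of_nonpos (by omega)]; omega)
      linarith
    · have h3 : (l : ℕ) < k := by
        rw [Fin.lt_def] at h1; rw [Fin.ext_iff] at h2; omega
      have e : (k : ℤ) - l - n = k - n - l := by ring
      rw [e, sub_right_comm, sub_self, zero_sub, norm_neg]
      linarith [hκ ((n : ℤ) + k - l) (by rw [abs_of_nonneg (by omega)]; omega)]
  have hsplit : WithLp.toLp 2 ((embeddingBlock a b n).mulVec x) =
      WithLp.toLp 2 (fun k : Fin n => coeff (n + k) T) +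
        WithLp.toLp 2 (fun k : Fin n => coeff (k - n) T) + WithLp.toLp 2 (E.mulVec x) := by
    ext k
    have hk := k.2
    have c1 : coeff (n + k : ℤ) T = coeff (n + k : ℤ) U := by
      rw [hT, map_sub, coeff_lowPart, if_neg (by omega), sub_zero]
    have c2 : coeff (k - n : ℤ) T = coeff (k - n : ℤ) U := by
      rw [hT, map_sub, coeff_lowPart, if_neg (by omega), sub_zero]
    simp only [PiLp.add_apply, c1, c2, hU, coeff_mul_trigPoly, coeff_symbol ha,
      Matrix.mulVec, dotProduct, ← Finset.sum_add_distrib, E]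
    refine Finset.sum_congr rfl fun l _ => ?_
    ring
  have hpart : ∀ e : Fin n → ℤ, Function.Injective e →
      ‖WithLp.toLp 2 (fun k : Fin n => coeff (e k) T)‖ ≤ √(sqNorm T) := fun e he => by
    refine Real.le_sqrt_of_sq_le ?_
    rw [EuclideanSpace.norm_sq_eq]
    exact sum_sq_coeff_le T he
  have hEx : ‖WithLp.toLp 2 (E.mulVec x)‖ ≤ 3 * n ^ 2 * κ * D := by
    have hentry : ∀ k, ‖E.mulVec x k‖ ≤ n * (3 * κ * D) := by
      intro k
      rw [Matrix.mulVec, dotProduct]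
      refine (norm_sum_le_of_le _ fun l _ => (norm_mul_le _ _).trans
        (mul_le_mul (hE k l) (hD l) (norm_nonneg _) (by positivity))).trans (by simp)
    -- For `n = 0` the bound `hD` is vacuous and the sign of `D` is unknown.
    rcases Nat.eq_zero_or_pos n with rfl | hn
    · simp
    have hD0 : 0 ≤ D := (norm_nonneg _).trans (hD ⟨0, hn⟩)
    refine (pow_le_pow_iff_left₀ (norm_nonneg _) (by positivity) two_ne_zero).1 ?_
    rw [EuclideanSpace.norm_sq_eq]
    calc ∑ k, ‖E.mulVec x k‖ ^ 2 ≤ ∑ _k : Fin n, (n * (3 * κ * D)) ^ 2 :=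
          Finset.sum_le_sum fun k _ => pow_le_pow_left₀ (norm_nonneg _) (hentry k) 2
      _ = n * (n * (3 * κ * D)) ^ 2 := by simp
      _ ≤ (n : ℝ) ^ 2 * (n * (3 * κ * D)) ^ 2 := by
          refine mul_le_mul_of_nonneg_right ?_ (by positivity)
          exact_mod_cast Nat.le_self_pow two_ne_zero n
      _ = _ := by ring
  rw [hsplit]
  refine (norm_add_le _ _).trans (add_le_add ((norm_add_le _ _).trans ?_) hEx)
  rw [two_mul]
  refine add_le_add (hpart (fun k => n + k) fun i j h => Fin.ext ?_)
    (hpart (fun k => k - n) fun i j h => Fin.ext ?_)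
  · simpa using h
  · simpa using h

/-- The factor `n ^ 2` comes from summing small matrix entries, `(n + d) ^ d` from dividing by `d`
linear factors. -/
theorem tendsto_poly_mul_exp_neg_nat {γ : ℝ} (hγ : 0 < γ) (d : ℕ) :
    Tendsto (fun n : ℕ => (n : ℝ) ^ 2 * (n + d) ^ d * Real.exp (-γ * n)) atTop (𝓝 0) := by
  have h1 : Tendsto (fun n : ℕ => γ * (n : ℝ)) atTop atTop :=
    tendsto_natCast_atTop_atTop.const_mul_atTop hγ
  have h2 := ((Real.tendsto_pow_mul_exp_neg_atTop_nhds_zero (d + 2)).comp h1).const_mul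
    (((d : ℝ) + 1) ^ d * (γ ^ (d + 2))⁻¹)
  rw [mul_zero] at h2
  refine squeeze_zero' (Eventually.of_forall fun n => by positivity) ?_ h2
  filter_upwards [eventually_ge_atTop 1] with n hn
  have hn' : (1 : ℝ) ≤ n := by exact_mod_cast hn
  have h3 : ((n : ℝ) + d) ^ d ≤ (d + 1) ^ d * n ^ d := by
    rw [← mul_pow]
    refine pow_le_pow_left₀ (by positivity) ?_ d
    nlinarith [(d.cast_nonneg : (0 : ℝ) ≤ d)]
  have h4 : ((d : ℝ) + 1) ^ d * (γ ^ (d + 2))⁻¹ * ((γ * n) ^ (d + 2) * Real.exp (-(γ * n))) =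
      (n : ℝ) ^ 2 * ((d + 1) ^ d * n ^ d) * Real.exp (-γ * n) := by
    rw [mul_pow, neg_mul]
    field_simp
    ring
  simp only [Function.comp]
  rw [h4]
  gcongr

theorem summable_norm_of_exp_decay {a : ℤ → ℂ} {C γ : ℝ} (hγ : 0 < γ)
    (ha : ∀ k : ℤ, ‖a k‖ ≤ C * Real.exp (-γ * |(k : ℝ)|)) :
    Summable fun k => ‖a k‖ :=
  Summable.of_nonneg_of_le (fun _ => norm_nonneg _) ha
    ((summable_exp_neg_mul_abs_int hγ).mul_left C)

theorem norm_le_exp_of_le_abs {a : ℤ → ℂ} {C γ : ℝ} (hγ : 0 < γ)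
    (ha : ∀ k : ℤ, ‖a k‖ ≤ C * Real.exp (-γ * |(k : ℝ)|))
    {n : ℕ} {k : ℤ} (hk : n ≤ |k|) :
    ‖a k‖ ≤ C * Real.exp (-γ * n) := by
  have hC : 0 ≤ C := by simpa using (norm_nonneg _).trans (ha 0)
  refine (ha k).trans (mul_le_mul_of_nonneg_left (Real.exp_le_exp.2 ?_) hC)
  have : (n : ℝ) ≤ |(k : ℝ)| := by exact_mod_cast hk
  nlinarith

/-! ### Bounds for the embedding block -/

/-- On a subspace of bounded codimension, `B_n` is small relative to `A_n`. -/
theorem exists_norm_embeddingBlock_mulVec_le_mul {a : ℤ → ℂ} {C γ : ℝ} (hγ : 0 < γ)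
    (ha : ∀ k : ℤ, ‖a k‖ ≤ C * Real.exp (-γ * |(k : ℝ)|))
    (hne : ∃ k, a k ≠ 0) {δ : ℝ} (hδ : 0 < δ) :
    ∃ m N : ℕ, ∀ n : ℕ, N ≤ n → ∀ b : ℂ, ‖b‖ ≤ C * Real.exp (-γ * n) → ∀ x : Fin n → ℂ,
      (∀ k : ℤ, (-(2 * m) ≤ k ∧ k < m) ∨ (n - m ≤ k ∧ k < n + 2 * m) →
        coeff k (symbol a * trigPoly x) = 0) →
      ‖WithLp.toLp 2 ((embeddingBlock a b n).mulVec x)‖ ≤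
        δ * ‖WithLp.toLp 2 ((toeplitzSection a n).mulVec x)‖ := by
  have hs := summable_norm_of_exp_decay hγ ha
  obtain ⟨s, q, hs1, hq, hP⟩ := exists_rootProd_eq_symbol_mul hγ ha hne
  -- The bound `1 / 2` gives `‖U‖ ≤ 2 y`; then `δ / 8` makes the outer part at most `δ / 4 * y`. It
  -- is counted twice, leaving `δ / 2` for the small entries.
  set η : ℝ := min (δ / 8) (1 / 2) with hηdef
  have hη : 0 < η := by positivity
  obtain ⟨c, h, m, hm, h1, h2⟩ := exists_hasBandwidth_mul_approx hq hP hη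
  have hlim := (tendsto_poly_mul_exp_neg_nat hγ s.card).const_mul (6 * C * ‖q‖)
  rw [mul_zero] at hlim
  obtain ⟨N, hN⟩ := eventually_atTop.1 (hlim.eventually_lt_const (half_pos hδ))
  refine ⟨max m s.card, N, fun n hn b hb x hx => ?_⟩
  set U := symbol a * trigPoly x with hU
  set y := ‖WithLp.toLp 2 ((toeplitzSection a n).mulVec x)‖ with hy
  have hy0 : 0 ≤ y := norm_nonneg _
  have hT := sqNorm_sub_lowPart_le (hm.mono (le_max_left _ _))
    (((hasBandwidth_rootProd s).smul c).mono (le_max_right _ _)) h1 h2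
    (fun k => coeff_trigPoly_eq_zero x) hx
  rw [← hU] at hT
  have hsplit := sqNorm_eq_lowPart_add n U
  rw [hU, sqNorm_lowPart_symbol_mul hs, ← hU, ← hy] at hsplit
  have hη1 : η ≤ δ / 8 := min_le_left _ _
  have hη2 : η ≤ 1 / 2 := min_le_right _ _
  have hη3 : η ^ 2 ≤ 1 / 4 := by nlinarith
  have hη4 : η ^ 2 ≤ δ ^ 2 / 64 := by nlinarith
  have hU0 := sqNorm_nonneg U
  have hU2 : sqNorm U ≤ (2 * y) ^ 2 := by nlinarith
  have hT2 : √(sqNorm (U - lowPart n U)) ≤ δ / 4 * y :=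
    Real.sqrt_le_iff.2 ⟨by positivity, by nlinarith⟩
  -- The product of `rootProd s` and `trigPoly x` is `q * U`, with `L²` norm at most `‖q‖ * (2 *
  -- y)`; dividing out the roots bounds `x`.
  have hx1 : ∀ l, ‖x l‖ ≤ (n + s.card) ^ s.card * (‖q‖ * (2 * y)) := by
    intro l
    rw [← coeff_trigPoly_apply x l]
    refine norm_coeff_le_of_mul_rootProd s hs1 (fun k => coeff_trigPoly_eq_zero x) (fun k => ?_) _
    refine (norm_coeff_le _ _).trans (Real.sqrt_le_iff.2 ⟨by positivity, ?_⟩)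
    rw [mul_pow]
    refine (sqNorm_le (H := U) (c := ‖q‖) fun t => ?_).trans
      (mul_le_mul_of_nonneg_left hU2 (by positivity))
    have : (rootProd s * trigPoly x) t = q t * U t := by
      simp [hP, hU]; ring
    rw [this, norm_mul]
    exact mul_le_mul_of_nonneg_right (q.norm_coe_le_norm t) (norm_nonneg _)
  refine (norm_embeddingBlock_mulVec_le hs (fun k hk => norm_le_exp_of_le_abs hγ ha hk) hb x
    hx1).trans ?_
  have e : 3 * (n : ℝ) ^ 2 * (C * Real.exp (-γ * n)) *
      ((n + s.card) ^ s.card * (‖q‖ * (2 * y))) =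
      6 * C * ‖q‖ * ((n : ℝ) ^ 2 * (n + s.card) ^ s.card * Real.exp (-γ * n)) * y := by ring
  rw [e]
  have := mul_le_mul_of_nonneg_right (hN n hn).le hy0
  linarith

/-- The matrices `B_n` are uniformly bounded. -/
theorem exists_norm_embeddingBlock_mulVec_le {a : ℤ → ℂ} {C γ : ℝ} (hγ : 0 < γ)
    (ha : ∀ k : ℤ, ‖a k‖ ≤ C * Real.exp (-γ * |(k : ℝ)|)) :
    ∃ N : ℕ, ∀ n : ℕ, N ≤ n → ∀ b : ℂ, ‖b‖ ≤ C * Real.exp (-γ * n) → ∀ x : Fin n → ℂ,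
      ‖WithLp.toLp 2 ((embeddingBlock a b n).mulVec x)‖ ≤
        (2 * ‖symbol a‖ + 1) * ‖WithLp.toLp 2 x‖ := by
  have hs := summable_norm_of_exp_decay hγ ha
  have hlim := (tendsto_poly_mul_exp_neg_nat hγ 0).const_mul (3 * C)
  rw [mul_zero] at hlim
  obtain ⟨N, hN⟩ := eventually_atTop.1 (hlim.eventually_lt_const one_pos)
  refine ⟨N, fun n hn b hb x => ?_⟩
  refine (norm_embeddingBlock_mulVec_le hs (fun k hk => norm_le_exp_of_le_abs hγ ha hk) hb x
    (PiLp.norm_apply_le (WithLp.toLp 2 x))).trans ?_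
  set U := symbol a * trigPoly x with hU
  have h1 : √(sqNorm (U - lowPart n U)) ≤ ‖symbol a‖ * ‖WithLp.toLp 2 x‖ := by
    refine Real.sqrt_le_iff.2 ⟨by positivity, ?_⟩
    have h2 := sqNorm_eq_lowPart_add n U
    have h3 := sqNorm_nonneg (lowPart n U)
    have h4 : sqNorm U ≤ ‖symbol a‖ ^ 2 * sqNorm (trigPoly x) := sqNorm_le fun t => by
      rw [hU, ContinuousMap.mul_apply, norm_mul]
      exact mul_le_mul_of_nonneg_right ((symbol a).norm_coe_le_norm t) (norm_nonneg _)
    rw [mul_pow, EuclideanSpace.norm_sq_eq]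
    rw [sqNorm_trigPoly] at h4
    linarith
  have h5 := mul_le_mul_of_nonneg_right (hN n hn).le (norm_nonneg (WithLp.toLp 2 x))
  simp only [pow_zero, mul_one] at h5
  linarith

/-! ### Counting eigenvalues -/

/-- A hermitian matrix which is bounded by `ε` on a subspace of codimension at most `#ι` has at most
`#ι` eigenvalues of absolute value exceeding `ε`. -/
theorem numEigenvaluesAbove_le_card {n : ℕ} {M : Matrix (Fin n) (Fin n) ℂ} (hM : M.IsHermitian)
    {ε : ℝ} (hε : 0 ≤ ε) {ι : Type*} [Fintype ι] (φ : (Fin n → ℂ) →ₗ[ℂ] ι → ℂ)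
    (h : ∀ x, φ x = 0 → ‖WithLp.toLp 2 (M.mulVec x)‖ ≤ ε * ‖WithLp.toLp 2 x‖) :
    numEigenvaluesAbove M ε ≤ Fintype.card ι := by
  classical
  set s : Finset (Fin n) := Finset.univ.filter fun i => ε < |hM.eigenvalues i| with hs
  have hcount : numEigenvaluesAbove M ε = s.card := by
    rw [numEigenvaluesAbove, hM.roots_charpoly_eq_eigenvalues, Multiset.countP_map, hs,
      Finset.card_def, Finset.filter_val]
    simp
  rw [hcount]
  by_contra! hlt
  let v : s → EuclideanSpace ℂ (Fin n) := fun i => hM.eigenvectorBasis i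
  have hv : Orthonormal ℂ v := hM.eigenvectorBasis.orthonormal.comp _ Subtype.val_injective
  let ψ : (s → ℂ) →ₗ[ℂ] ι → ℂ :=
    φ ∘ₗ (WithLp.linearEquiv 2 ℂ (Fin n → ℂ)).toLinearMap ∘ₗ Fintype.linearCombination ℂ v
  -- More eigenvectors than constraints: some nonzero combination is killed by `φ`, yet `M`
  -- stretches it by more than `ε`.
  have hker : LinearMap.ker ψ ≠ ⊥ := LinearMap.ker_ne_bot_of_finrank_lt (by simpa using hlt)
  obtain ⟨c, hc, hc0⟩ := (Submodule.ne_bot_iff _).1 hker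
  have hnorm : ∀ d : s → ℂ, ‖∑ i, d i • v i‖ ^ 2 = ∑ i, ‖d i‖ ^ 2 := fun d => by
    have h1 := hv.inner_sum d d Finset.univ
    rw [inner_self_eq_norm_sq_to_K] at h1
    have h2 : ∀ i, (starRingEnd ℂ) (d i) * d i = ((‖d i‖ ^ 2 : ℝ) : ℂ) := fun i => by
      rw [mul_comm, Complex.mul_conj, Complex.normSq_eq_norm_sq]
    simp only [h2] at h1
    rw [← Complex.ofReal_sum] at h1
    exact Complex.ofReal_injective ((Complex.ofReal_pow _ _).trans h1)
  have hbound := h (∑ i : s, c i • v i).ofLp hc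
  have hMw : WithLp.toLp 2 (M.mulVec (∑ i : s, c i • v i).ofLp) =
      ∑ i : s, ((hM.eigenvalues i : ℂ) * c i) • v i := by
    refine WithLp.ofLp_injective 2 ?_
    rw [WithLp.ofLp_sum 2 _ Finset.univ fun i : s => c i • v i,
      WithLp.ofLp_sum 2 _ Finset.univ fun i : s => ((hM.eigenvalues i : ℂ) * c i) • v i, Matrix.mulVec_sum,
      WithLp.ofLp_toLp]
    refine Finset.sum_congr rfl fun i _ => ?_
    rw [WithLp.ofLp_smul, Matrix.mulVec_smul, hM.mulVec_eigenvectorBasis, WithLp.ofLp_smul,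
      mul_comm, mul_smul]
    rfl
  rw [hMw, WithLp.toLp_ofLp] at hbound
  have hsq := pow_le_pow_left₀ (norm_nonneg _) hbound 2
  rw [mul_pow, hnorm, hnorm, Finset.mul_sum] at hsq
  refine absurd hsq (not_le.2 ?_)
  obtain ⟨i, hi⟩ := Function.ne_iff.1 hc0
  have hpos : ∀ i : s, ε ^ 2 < ‖(hM.eigenvalues i : ℂ)‖ ^ 2 := fun i => by
    rw [Complex.norm_real]
    exact pow_lt_pow_left₀ (Finset.mem_filter.1 i.2).2 hε two_ne_zero
  refine Finset.sum_lt_sum (fun j _ => ?_) ⟨i, Finset.mem_univ _, ?_⟩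
  · rw [norm_mul, mul_pow]
    exact mul_le_mul_of_nonneg_right (hpos j).le (by positivity)
  · rw [norm_mul, mul_pow]
    exact mul_lt_mul_of_pos_right (hpos i) (pow_pos (norm_pos_iff.2 hi) 2)

/-! ### Hermitian structure and conclusion -/

theorem toeplitzSection_isHermitian {a : ℤ → ℂ} (h : ∀ k : ℤ, a (-k) = star (a k)) (n : ℕ) :
    (toeplitzSection a n).IsHermitian := by
  ext k l
  rw [Matrix.conjTranspose_apply, toeplitzSection, toeplitzSection, ← h, neg_sub]

/-- Lets the uniform bound for embedding blocks apply to `B_nᴴ` as well. -/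
theorem embeddingBlock_conjTranspose {a : ℤ → ℂ} (h : ∀ k : ℤ, a (-k) = star (a k)) (b : ℂ)
    (n : ℕ) : (embeddingBlock a b n).conjTranspose = embeddingBlock a (star b) n := by
  ext k l
  rw [Matrix.conjTranspose_apply]
  simp only [embeddingBlock]
  rcases lt_trichotomy k l with hkl | rfl | hkl
  · rw [if_neg hkl.not_gt, if_neg hkl.ne', if_pos hkl, ← h]
    congr 1; ring
  · simp
  · rw [if_pos hkl, if_neg hkl.not_gt, if_neg hkl.ne', ← h]
    congr 1; ring

/-- The linear functionals sending `x` to the entries of the convolution `a * y` at the positions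
in `s`, where `y = L x`. -/
noncomputable def convolutionEntries (a : ℤ → ℂ) {n : ℕ} (L : Matrix (Fin n) (Fin n) ℂ)
    (s : Finset ℤ) : (Fin n → ℂ) →ₗ[ℂ] s → ℂ where
  toFun x k := coeff (k : ℤ) (symbol a * trigPoly (L.mulVec x))
  map_add' x y := by
    ext k
    simp only [coeff_mul_trigPoly, Matrix.mulVec_add, Pi.add_apply, mul_add,
      Finset.sum_add_distrib]
  map_smul' c x := by
    ext k
    simp only [coeff_mul_trigPoly, Matrix.mulVec_smul, Pi.smul_apply, smul_eq_mul,
      RingHom.id_apply, Finset.mul_sum, mul_left_comm]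

theorem mainTheorem6 (a : ℤ → ℂ) (C γ : ℝ) (hγ : 0 < γ)
    (hherm : ∀ k : ℤ, a (-k) = star (a k))
    (hdecay : ∀ k : ℤ, ‖a k‖ ≤ C * Real.exp (-γ * |(k : ℝ)|))
    (b₀ : ℕ → ℂ) (hb₀ : ∀ n : ℕ, b₀ n = a (n : ℤ) ∨ b₀ n = 0) :
    ∀ ε : ℝ, 0 < ε → ∃ N M : ℕ, ∀ n : ℕ, N < n → IsUnit (toeplitzSection a n) →
      numEigenvaluesAbove (toeplitzSection a n - embeddingSchur a (b₀ n) n) ε ≤ M := by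
  intro ε hε
  by_cases hne : ∃ k, a k ≠ 0
  swap
  -- For the zero sequence no `A_n` with `n > 0` is invertible.
  · push Not at hne
    refine ⟨0, 0, fun n hn hA => ?_⟩
    have : Nonempty (Fin n) := ⟨⟨0, hn⟩⟩
    have h0 : toeplitzSection a n = 0 := by
      ext k l
      exact hne _
    rw [h0] at hA
    exact absurd hA not_isUnit_zero
  set K : ℝ := 2 * ‖symbol a‖ + 1 with hK
  have hK0 : 0 < K := by positivity
  obtain ⟨N₁, hN₁⟩ := exists_norm_embeddingBlock_mulVec_le hγ hdecay
  obtain ⟨m, N₂, hN₂⟩ :=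
    exists_norm_embeddingBlock_mulVec_le_mul hγ hdecay hne (div_pos hε hK0)
  -- The conditions kill two blocks of `3 * m` frequencies.
  refine ⟨max N₁ N₂, 6 * m, fun n hn hA => ?_⟩
  have hC : 0 ≤ C := by simpa using (norm_nonneg _).trans (hdecay 0)
  have hb : ‖b₀ n‖ ≤ C * Real.exp (-γ * n) := by
    rcases hb₀ n with h | h
    · rw [h]
      exact norm_le_exp_of_le_abs hγ hdecay (le_abs_self _)
    · rw [h, norm_zero]
      positivity
  set A := toeplitzSection a n with hAdef
  set B := embeddingBlock a (b₀ n) n with hBdef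
  have hM : A - embeddingSchur a (b₀ n) n = B * A⁻¹ * B.conjTranspose := by
    rw [embeddingSchur, sub_sub_cancel]
  rw [hM]
  have hMh : (B * A⁻¹ * B.conjTranspose).IsHermitian :=
    Matrix.isHermitian_mul_mul_conjTranspose B (toeplitzSection_isHermitian hherm n).inv
  set s : Finset ℤ := Finset.Ico (-(2 * m : ℤ)) m ∪ Finset.Ico ((n : ℤ) - m) (n + 2 * m) with hs
  have hcard : Fintype.card s ≤ 6 * m := by
    rw [Fintype.card_coe]
    refine (Finset.card_union_le _ _).trans ?_
    rw [Int.card_Ico, Int.card_Ico]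
    omega
  refine (numEigenvaluesAbove_le_card hMh hε.le
    (convolutionEntries a (A⁻¹ * B.conjTranspose) s) fun x hx => ?_).trans hcard
  have hzero : ∀ k : ℤ, (-(2 * m) ≤ k ∧ k < m) ∨ (n - m ≤ k ∧ k < n + 2 * m) →
      coeff k (symbol a * trigPoly ((A⁻¹ * B.conjTranspose).mulVec x)) = 0 := fun k hk =>
    congrFun hx ⟨k, by simpa [hs] using hk⟩
  have h1 := hN₂ n ((le_max_right _ _).trans hn.le) (b₀ n) hb _ hzero
  have h2 := hN₁ n ((le_max_left _ _).trans hn.le) (star (b₀ n)) (by rwa [norm_star]) x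
  rw [← embeddingBlock_conjTranspose hherm, ← hBdef] at h2
  -- On the right `A` cancels `A⁻¹`, leaving `Bᴴ x`; no bound on `A⁻¹` is needed.
  rw [Matrix.mulVec_mulVec, Matrix.mulVec_mulVec, ← Matrix.mul_assoc, ← Matrix.mul_assoc,
    ← hAdef, ← hBdef, Matrix.mul_nonsing_inv A ((Matrix.isUnit_iff_isUnit_det A).1 hA),
    Matrix.one_mul] at h1
  calc _ ≤ _ := h1
    _ ≤ ε / K * (K * ‖WithLp.toLp 2 x‖) := mul_le_mul_of_nonneg_left h2 (by positivity)
    _ = ε * ‖WithLp.toLp 2 x‖ := by field_simp
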